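/- Let $A=(a_{i,j})_{i,j\in I_A}$ be an indecomposable Kac–Moody matrix (generalized Cartan matrix) of affine type, i.e. of corank $1$, with $Au=0$ for some real vector $u>0$, and such that $Av\ge 0$ implies $Av=0$. Let $(A,X,Y,(\alpha_i)_{i\in I_A},(\alpha_i^\vee)_{i\in I_A})$ be a Kac–Moody root datum: $X,Y$ are dual free $\mathbb{Z}$-modules of finite rank, $(\alpha_i)$ and $(\alpha_i^\vee)$ are $\mathbb{Z}$-linearly independent families in $X$ and $Y$, and $a_{i,j}=\alpha_j(\alpha_i^\vee)$. Put $\mathbb{A}=Y\otimes\mathbb{R}$, let $W_0\subset \mathrm{GL}(\mathbb{A})$ be the Weyl group, generated by the $r_i(v)=v-\alpha_i(v)\alpha_i^\vee$, and let $C^v_f=\{v\in\mathbb{A}\mid \alpha_i(v)>0\ \forall i\}$, $\mathcal{T}=\bigcup_{w\in W_0}w(\overline{C^v_f})$, $Y^+=Y\cap\mathcal{T}$ and $Q^\vee_+=\bigoplus_i\mathbb{Z}_{\ge0}\alpha_i^\vee$. A set $E\subset Y$ is *almost finite* if $E\subset J-Q^\vee_+$ for some finite $J\subset Y$, and *Weyl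 almost finite* if $W_0\cdot E$ is almost finite. For $u\in W_0$, a set $E\subset Y^+$ is *$u$-almost finite* if $u\cdot E$ is almost finite, and *$W_0$-almost finite* if this holds for every $u\in W_0$. (1) For all $\lambda\in Y\cap C^v_f$ and $i\in I_A$, the set $E=\{w(\lambda)+\alpha_i^\vee\mid w\in W_0\}$ is contained in $Y^+$ and is $u$-almost finite for every $u\in W_0$, but is not Weyl almost finite. (2) Let $\mathcal{R}$ be a nonzero commutative ring, and consider formal series $\sum_{w\in W_0,\lambda\in Y^+}a_{w,\lambda}T_wZ^\lambda$ with $a_{w,\lambda}\in\mathcal{R}$. Let $\widehat{\mathcal{H}}$ be the set of the series such that $\{w\mid a_{w,\lambda}\ne0\}$ is finite for every $\lambda\in Y^+$ and $\{\lambda\mid \exists w,\ a_{w,\lambda}\neq0\}$ is Weyl almost finite. Let $\widetilde{\mathcal{H}}=\bigoplus_{w\in W_0}T_w\mathscr{A}$ (the underlying set of the Abdellatif–Hébert completion) be the set of the series such that $\{w\mid\exists\lambda,\ a_{w,\lambda}\neq 0\}$ is finite and $\{\lambda\mid a_{w,\lambda}\ne0\}$ is $W_0$-almost finite for every $w$.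 Then $\widehat{\mathcal{H}}\not\subset\widetilde{\mathcal{H}}$ and $\widetilde{\mathcal{H}}\not\subset\widehat{\mathcal{H}}$. -/

import Mathlib

open scoped TensorProduct

noncomputable section

namespace KacMoody

/-! ### Kac-Moody matrices -/

/-- A Kac-Moody matrix (generalized Cartan matrix), indexed by a finite set `ι`. -/
structure IsKacMoodyMatrix {ι : Type*} (A : Matrix ι ι ℤ) : Prop where
  diag : ∀ i, A i i = 2
  nonpos : ∀ i j, i ≠ j → A i j ≤ 0
  zero_iff : ∀ i j, A i j = 0 ↔ A j i = 0

/-- `A` is indecomposable: the index set is non-empty and is not a disjoint union of two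
non-empty subsets `J` and `Jᶜ` such that the two off-diagonal blocks of `A` vanish. -/
def IsIndecomposable {ι : Type*} (A : Matrix ι ι ℤ) : Prop :=
  Nonempty ι ∧ ∀ J : Set ι, J.Nonempty → Jᶜ.Nonempty →
    ∃ i ∈ J, ∃ j ∈ Jᶜ, A i j ≠ 0 ∨ A j i ≠ 0

/-- `A` is of affine type (for an indecomposable Kac-Moody matrix): the corank is `1`, there is
a vector `u > 0` with `A u = 0`, and `A v ≥ 0` implies `A v = 0`. -/
structure IsAffine {ι : Type*} [Fintype ι] (A : Matrix ι ι ℤ) : Prop where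
  corank : (A.map (Int.cast : ℤ → ℝ)).rank + 1 = Fintype.card ι
  exists_pos : ∃ u : ι → ℝ, (∀ i, 0 < u i) ∧ (A.map (Int.cast : ℤ → ℝ)).mulVec u = 0
  nonneg_imp : ∀ v : ι → ℝ, (∀ i, 0 ≤ (A.map (Int.cast : ℤ → ℝ)).mulVec v i) →
    (A.map (Int.cast : ℤ → ℝ)).mulVec v = 0

/-! ### Kac-Moody root data -/

/-- A Kac-Moody root datum `(A, X, Y, (α_i), (α_i^∨))`: the free `ℤ`-modules `X`, `Y` of finite
rank are in duality through a perfect pairing, simple roots and simple coroots are free families,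
and `a_{i,j} = α_j(α_i^∨)`. -/
structure RootDatum (ι X Y : Type*) [AddCommGroup X] [Module.Free ℤ X] [Module.Finite ℤ X]
    [AddCommGroup Y] [Module.Free ℤ Y] [Module.Finite ℤ Y] where
  /-- the Kac-Moody matrix -/
  A : Matrix ι ι ℤ
  isKacMoodyMatrix : IsKacMoodyMatrix A
  /-- the duality between characters and cocharacters -/
  pairing : X →ₗ[ℤ] Y →ₗ[ℤ] ℤ
  isPerfPair : pairing.IsPerfPair
  /-- the simple roots -/
  root : ι → X
  /-- the simple coroots -/
  coroot : ι → Y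
  linearIndependent_root : LinearIndependent ℤ root
  linearIndependent_coroot : LinearIndependent ℤ coroot
  matrix_eq : ∀ i j, A i j = pairing (root j) (coroot i)

namespace RootDatum

variable {ι X Y : Type*} [AddCommGroup X] [Module.Free ℤ X] [Module.Finite ℤ X]
  [AddCommGroup Y] [Module.Free ℤ Y] [Module.Finite ℤ Y]

/-- The real vector space `𝔸 = Y ⊗ ℝ`. -/
abbrev Apartment (_D : RootDatum ι X Y) : Type _ := ℝ ⊗[ℤ] Y

variable (D : RootDatum ι X Y)

/-- The linear form on `𝔸` induced by a character. -/
def charForm (x : X) : D.Apartment →ₗ[ℝ] ℝ :=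
  (TensorProduct.AlgebraTensorModule.rid ℤ ℝ ℝ).toLinearMap ∘ₗ (D.pairing x).baseChange ℝ

theorem charForm_tmul (x : X) (r : ℝ) (y : Y) :
    D.charForm x (r ⊗ₜ[ℤ] y) = (D.pairing x y : ℝ) * r := by
  simp [charForm]

/-- The cocharacter lattice `Y`, seen inside `𝔸`. -/
def cochar : AddSubgroup D.Apartment :=
  (TensorProduct.mk ℤ ℝ Y 1).toAddMonoidHom.range

/-- The simple root `α_i`, as a linear form on `𝔸`. -/
def simpleRoot (i : ι) : D.Apartment →ₗ[ℝ] ℝ := D.charForm (D.root i)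

/-- The simple coroot `α_i^∨`, as an element of `𝔸`. -/
def simpleCoroot (i : ι) : D.Apartment := (1 : ℝ) ⊗ₜ[ℤ] D.coroot i

theorem simpleRoot_simpleCoroot (i : ι) : D.simpleRoot i (D.simpleCoroot i) = 2 := by
  simp [simpleRoot, simpleCoroot, charForm_tmul, ← D.matrix_eq, D.isKacMoodyMatrix.diag]

/-- The simple reflection `r_i(v) = v - α_i(v) α_i^∨`. -/
def simpleReflection (i : ι) : D.Apartment ≃ₗ[ℝ] D.Apartment :=
  Module.reflection (D.simpleRoot_simpleCoroot i)

theorem simpleReflection_apply (i : ι) (v : D.Apartment) :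
    D.simpleReflection i v = v - D.simpleRoot i v • D.simpleCoroot i :=
  Module.reflection_apply _ _

/-- The Weyl group `W_0`, the subgroup of `GL(𝔸)` generated by the simple reflections. -/
def weylGroup : Subgroup (D.Apartment ≃ₗ[ℝ] D.Apartment) :=
  Subgroup.closure (Set.range D.simpleReflection)

/-- The fundamental chamber `C^v_f`. -/
def chamber : Set D.Apartment := {v | ∀ i, 0 < D.simpleRoot i v}

/-- The closed fundamental chamber. As the simple roots are linearly independent, this is the
closure of `C^v_f`. -/
def closedChamber : Set D.Apartment := {v | ∀ i, 0 ≤ D.simpleRoot i v}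

/-- The Tits cone `𝒯`, the union of the `w(closure of C^v_f)` over `w ∈ W_0`. -/
def titsCone : Set D.Apartment :=
  {v | ∃ w ∈ D.weylGroup, ∃ x ∈ D.closedChamber, v = w x}

/-- `Y^+ = Y ∩ 𝒯`. -/
def cocharPlus : Set D.Apartment := (D.cochar : Set D.Apartment) ∩ D.titsCone

/-- `Q^∨_+`, the set of combinations of simple coroots with coefficients in `ℤ_{≥ 0}`. -/
def corootCone : AddSubmonoid D.Apartment :=
  AddSubmonoid.closure (Set.range D.simpleCoroot)

/-! ### Almost finite sets -/

/-- `E` is almost finite: `E ⊆ J - Q^∨_+` for some finite `J ⊆ Y`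
(in particular `E ⊆ Y`). -/
def AlmostFinite (E : Set D.Apartment) : Prop :=
  ∃ J : Set D.Apartment, J.Finite ∧ J ⊆ D.cochar ∧
    ∀ x ∈ E, ∃ ν ∈ J, ∃ κ ∈ D.corootCone, x = ν - κ

/-- The set `W_0 · E`. -/
def weylOrbit (E : Set D.Apartment) : Set D.Apartment :=
  {x | ∃ w ∈ D.weylGroup, ∃ y ∈ E, x = w y}

/-- `E` is Weyl almost finite: `W_0 · E` is almost finite. -/
def WeylAlmostFinite (E : Set D.Apartment) : Prop :=
  D.AlmostFinite (D.weylOrbit E)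

/-- For `u ∈ W_0`, a subset `E` of `Y^+` is `u`-almost finite if `u · E` is almost finite. -/
def UAlmostFinite (u : D.weylGroup) (E : Set D.Apartment) : Prop :=
  E ⊆ D.cocharPlus ∧ D.AlmostFinite ((fun x => u.1 x) '' E)

/-- A subset `E` of `Y^+` is `W_0`-almost finite if it is `u`-almost finite for all `u ∈ W_0`. -/
def W0AlmostFinite (E : Set D.Apartment) : Prop :=
  ∀ u : D.weylGroup, D.UAlmostFinite u E

variable {D}

theorem AlmostFinite.mono {E F : Set D.Apartment} (hF : D.AlmostFinite F) (h : E ⊆ F) :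
    D.AlmostFinite E := by
  obtain ⟨J, h1, h2, h3⟩ := hF
  exact ⟨J, h1, h2, fun x hx => h3 x (h hx)⟩

theorem AlmostFinite.empty : D.AlmostFinite ∅ :=
  ⟨∅, Set.finite_empty, by simp, by simp⟩

theorem AlmostFinite.union {E F : Set D.Apartment} (hE : D.AlmostFinite E)
    (hF : D.AlmostFinite F) : D.AlmostFinite (E ∪ F) := by
  obtain ⟨J, h1, h2, h3⟩ := hE
  obtain ⟨K, k1, k2, k3⟩ := hF
  refine ⟨J ∪ K, h1.union k1, Set.union_subset h2 k2, ?_⟩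
  rintro x (hx | hx)
  · obtain ⟨ν, hν, h⟩ := h3 x hx
    exact ⟨ν, Or.inl hν, h⟩
  · obtain ⟨ν, hν, h⟩ := k3 x hx
    exact ⟨ν, Or.inr hν, h⟩

theorem WeylAlmostFinite.mono {E F : Set D.Apartment} (hF : D.WeylAlmostFinite F) (h : E ⊆ F) :
    D.WeylAlmostFinite E := by
  refine AlmostFinite.mono hF ?_
  rintro x ⟨w, hw, y, hy, rfl⟩
  exact ⟨w, hw, y, h hy, rfl⟩

theorem WeylAlmostFinite.empty : D.WeylAlmostFinite ∅ := by
  refine AlmostFinite.mono AlmostFinite.empty ?_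
  rintro x ⟨w, hw, y, hy, rfl⟩
  exact hy.elim

theorem WeylAlmostFinite.union {E F : Set D.Apartment} (hE : D.WeylAlmostFinite E)
    (hF : D.WeylAlmostFinite F) : D.WeylAlmostFinite (E ∪ F) := by
  refine AlmostFinite.mono (AlmostFinite.union hE hF) ?_
  rintro x ⟨w, hw, y, hy | hy, rfl⟩
  · exact Or.inl ⟨w, hw, y, hy, rfl⟩
  · exact Or.inr ⟨w, hw, y, hy, rfl⟩

theorem W0AlmostFinite.mono {E F : Set D.Apartment} (hF : D.W0AlmostFinite F) (h : E ⊆ F) :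
    D.W0AlmostFinite E := fun u =>
  ⟨h.trans (hF u).1, (hF u).2.mono (Set.image_mono h)⟩

theorem W0AlmostFinite.empty : D.W0AlmostFinite ∅ := fun u =>
  ⟨Set.empty_subset _, by rw [Set.image_empty]; exact AlmostFinite.empty⟩

theorem W0AlmostFinite.union {E F : Set D.Apartment} (hE : D.W0AlmostFinite E)
    (hF : D.W0AlmostFinite F) : D.W0AlmostFinite (E ∪ F) := fun u =>
  ⟨Set.union_subset (hE u).1 (hF u).1, by
    rw [Set.image_union]; exact AlmostFinite.union (hE u).2 (hF u).2⟩

/-! ### The two completions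

The formal series `∑_{w ∈ W_0, λ ∈ Y^+} a_{w,λ} T_w Z^λ` with coefficients in `R` are the families
`a : W_0 → Y^+ → R`. Both completions are `R`-submodules of the module of all these series. -/

variable (D) (R : Type*) [CommRing R]

/-- The module of all formal series `∑ a_{w,λ} T_w Z^λ`, `w ∈ W_0`, `λ ∈ Y^+`. -/
abbrev Series : Type _ := D.weylGroup → D.cocharPlus → R

/-- The completed Iwahori-Hecke algebra `Ĥ`, as a module of series: the series
`∑_{λ ∈ Y^+} h_λ Z^λ` where each `h_λ = ∑_w a_{w,λ} T_w` belongs to the Hecke algebra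
`⨁_{w ∈ W_0} R T_w` of `W_0` (so that `a_{w,λ} ≠ 0` for finitely many `w` only), and where
the set of all `λ` such that `h_λ ≠ 0` is Weyl almost finite. -/
def hatH : Submodule R (D.Series R) where
  carrier := {a | (∀ l, {w | a w l ≠ 0}.Finite) ∧
    D.WeylAlmostFinite (Subtype.val '' {l : D.cocharPlus | ∃ w, a w l ≠ 0})}
  zero_mem' := by
    refine ⟨fun l => by simp, ?_⟩
    simpa using WeylAlmostFinite.empty
  add_mem' := by
    intro a b ha hb
    refine ⟨fun l => ((ha.1 l).union (hb.1 l)).subset ?_, (ha.2.union hb.2).mono ?_⟩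
    · intro w hw
      by_contra h
      simp only [Set.mem_union, Set.mem_ofPred_eq, not_or, not_not] at h
      exact hw (by simp [h.1, h.2])
    · rw [← Set.image_union]
      refine Set.image_mono ?_
      rintro l ⟨w, hw⟩
      by_contra h
      simp only [Set.mem_union, Set.mem_ofPred_eq, not_or, not_exists, not_not] at h
      exact hw (by simp [h.1 w, h.2 w])
  smul_mem' := by
    intro c a ha
    refine ⟨fun l => (ha.1 l).subset fun w hw h => hw (by simp [h]),
      ha.2.mono (Set.image_mono ?_)⟩
    rintro l ⟨w, hw⟩
    exact ⟨w, fun h => hw (by simp [h])⟩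

/-- The module `𝒜` of the series `∑_{λ ∈ Y^+} c_λ Z^λ` with `W_0`-almost finite support. -/
def seriesA : Submodule R (D.cocharPlus → R) where
  carrier := {c | D.W0AlmostFinite (Subtype.val '' {l : D.cocharPlus | c l ≠ 0})}
  zero_mem' := by simpa using W0AlmostFinite.empty
  add_mem' := by
    intro a b ha hb
    refine (W0AlmostFinite.union ha hb).mono ?_
    rw [← Set.image_union]
    refine Set.image_mono fun l hl => ?_
    by_contra h
    simp only [Set.mem_union, Set.mem_ofPred_eq, not_or, not_not] at h
    exact hl (by simp [h.1, h.2])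
  smul_mem' := by
    intro c a ha
    exact W0AlmostFinite.mono ha (Set.image_mono fun l hl h => hl (by simp [h]))

/-- The completion `H̃ = ⨁_{w ∈ W_0} T_w 𝒜` of Abdellatif and Hébert, as a module of series: the
finite sums `∑_w T_w θ_w` with `θ_w ∈ 𝒜`. -/
def tildeH : Submodule R (D.Series R) where
  carrier := {a | {w | a w ≠ 0}.Finite ∧ ∀ w, a w ∈ D.seriesA R}
  zero_mem' := ⟨by simp, fun w => (D.seriesA R).zero_mem⟩
  add_mem' := by
    intro a b ha hb
    refine ⟨(ha.1.union hb.1).subset ?_, fun w => (D.seriesA R).add_mem (ha.2 w) (hb.2 w)⟩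
    intro w hw
    by_contra h
    simp only [Set.mem_union, Set.mem_ofPred_eq, not_or, not_not] at h
    exact hw (by simp [h.1, h.2])
  smul_mem' := by
    intro c a ha
    exact ⟨ha.1.subset fun w hw h => hw (by simp [h]),
      fun w => (D.seriesA R).smul_mem c (ha.2 w)⟩

end RootDatum

end KacMoody

end

namespace KacMoody

/-! ### Affine matrices: symmetrizability and the semidefinite invariant form. -/

section Combinatorics

variable {ι : Type*} {A : Matrix ι ι ℤ}

/-! Order points by differences in $Q^\vee_+$. A regular dominant $\lambda\in Y$ is the largest
point of its orbit (`sub_mem_corootCone`), so $u(w\lambda+\alpha_i^\vee)\le\lambda+u\alpha_i^\vee$: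
for fixed $u$ a single upper bound suffices. But $W_0\cdot E$ contains $\lambda+w\alpha_i^\vee$ for
all $w$, and the heights of the real coroots $w\alpha_i^\vee$ are unbounded
(`exists_height_coroot_gt`), while heights are bounded above on $J-Q^\vee_+$ with $J$ finite.

The maximality of $\lambda$ and the inclusion $\lambda+Q^\vee\subset\mathcal T$ are obtained without
Coxeter theory, by a rewriting system on the coordinates $x$ of $\lambda+\sum_j x_j\alpha_j^\vee$:
reflect in any simple root that is negative at the point, which increases $x$. Climbing terminates
because an affine matrix is symmetrizable with a positive semidefinite form, and each step lowers
the form of $x$ by a fixed amount (`exists_measure_climb`). It is locally confluent because two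
simple roots negative at a point of positive level span a finite root system
(`entry_mul_entry_le_three`). By Newman's lemma the normal form is unique, so the points climbing to
$\lambda$ form a $W_0$-stable set, which contains the orbit.

The completions are separated by $\sum_{\mu\in W_0\lambda}T_{w_\mu}Z^\mu$ with $w_\mu\lambda=\mu$,
which involves infinitely many $w$, and by $T_1\sum_{\mu\in E}Z^\mu$, whose support is not Weyl
almost finite. -/

theorem neg_entry_nonneg (hA : IsKacMoodyMatrix A) {i j : ι} (h : i ≠ j) :
    (0 : ℝ) ≤ -(A i j : ℝ) := by
  have := hA.nonpos i j h
  have : (A i j : ℝ) ≤ 0 := by exact_mod_cast this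
  linarith

theorem one_le_entry_mul_entry (hA : IsKacMoodyMatrix A) {i j : ι} (h : i ≠ j)
    (h0 : A i j ≠ 0) : (1 : ℝ) ≤ (A i j : ℝ) * A j i := by
  have h1 := hA.nonpos i j h
  have h2 := hA.nonpos j i h.symm
  have h3 : A j i ≠ 0 := fun e => h0 ((hA.zero_iff i j).2 e)
  have h1' : A i j ≤ -1 := by omega
  have h2' : A j i ≤ -1 := by omega
  have : 1 ≤ A i j * A j i := by nlinarith
  exact_mod_cast this

/-- A non-empty set of indices without edges to its complement is everything. -/
theorem IsIndecomposable.eq_univ (hA : IsKacMoodyMatrix A) (hind : IsIndecomposable A)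
    {C : Finset ι} (hC : C.Nonempty) (h : ∀ i ∈ C, ∀ k ∉ C, A i k = 0) (k : ι) : k ∈ C := by
  by_contra hk
  obtain ⟨i, hi, j, hj, hij⟩ := hind.2 (C : Set ι) hC ⟨k, by simpa using hk⟩
  have h0 := h i (by simpa using hi) j (by simpa using hj)
  rcases hij with hij | hij
  · exact hij h0
  · exact hij ((hA.zero_iff i j).1 h0)

/-- The normalized off-diagonal entries `|a_{i,j}| u_j / u_i`. -/
noncomputable def normEntry [DecidableEq ι] (A : Matrix ι ι ℤ) (u : ι → ℝ) (i j : ι) : ℝ :=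
  if i = j then 0 else -(A i j : ℝ) * u j / u i

/-- The adjacency function of the Dynkin diagram. -/
noncomputable def adjEntry [DecidableEq ι] (A : Matrix ι ι ℤ) (i j : ι) : ℝ :=
  if i ≠ j ∧ A i j ≠ 0 then 1 else 0

section Cycle

variable [DecidableEq ι] (hA : IsKacMoodyMatrix A) {u : ι → ℝ} (hpos : ∀ i, 0 < u i)

include hA hpos in
theorem normEntry_nonneg (i j : ι) : 0 ≤ normEntry A u i j := by
  unfold normEntry
  split_ifs with h
  · exact le_rfl
  · exact div_nonneg (mul_nonneg (neg_entry_nonneg hA h) (hpos j).le) (hpos i).le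

include hpos in
theorem normEntry_mul {i j : ι} (h : i ≠ j) :
    normEntry A u i j * normEntry A u j i = (A i j : ℝ) * A j i := by
  have := (hpos i).ne'
  have := (hpos j).ne'
  simp only [normEntry, h, h.symm, if_false]
  field_simp

include hA hpos in
-- This is the AM–GM inequality: along an edge the product of the two normalized entries is
-- $a_{i,j}a_{j,i}\ge 1$, so their sum is at least $2$.
theorem two_mul_adjEntry_le (i j : ι) :
    2 * adjEntry A i j ≤ normEntry A u i j + normEntry A u j i := by
  have h1 := normEntry_nonneg hA hpos i j
  have h2 := normEntry_nonneg hA hpos j i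
  by_cases h : i ≠ j ∧ A i j ≠ 0
  · have h3 := one_le_entry_mul_entry hA h.1 h.2
    rw [← normEntry_mul hpos h.1] at h3
    simp only [adjEntry, h, ne_eq, not_false_eq_true, and_self, if_true]
    nlinarith [sq_nonneg (normEntry A u i j - normEntry A u j i)]
  · simp only [adjEntry, h, if_false]
    linarith

include hA in
/-- If every non-empty set of indices has a vertex with at most one neighbour in it, then the
matrix is symmetrizable. -/
theorem symmetrizable_of_leaf
    (hleaf : ∀ C : Finset ι, C.Nonempty → ∃ i ∈ C, ∑ j ∈ C, adjEntry A i j < 2)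
    (C : Finset ι) : ∃ ε : ι → ℝ, (∀ i, 0 < ε i) ∧
      ∀ i ∈ C, ∀ j ∈ C, ε i * A j i = ε j * A i j := by
  induction C using Finset.strongInduction with
  | H C ih =>
  rcases C.eq_empty_or_nonempty with rfl | hC
  · exact ⟨fun _ => 1, by simp, by simp⟩
  obtain ⟨i, hi, hdeg⟩ := hleaf C hC
  obtain ⟨ε, hε, h⟩ := ih _ (Finset.erase_ssubset hi)
  by_cases hn : ∃ k ∈ C.erase i, A i k ≠ 0
  · obtain ⟨k, hk, hik⟩ := hn
    have hki : k ≠ i := Finset.ne_of_mem_erase hk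
    have huniq : ∀ j ∈ C.erase i, j ≠ k → A i j = 0 := by
      intro j hj hjk
      by_contra hij
      have hji : j ≠ i := Finset.ne_of_mem_erase hj
      have hsub : ({j, k} : Finset ι) ⊆ C := by
        intro z hz
        simp only [Finset.mem_insert, Finset.mem_singleton] at hz
        rcases hz with rfl | rfl
        · exact Finset.mem_of_mem_erase hj
        · exact Finset.mem_of_mem_erase hk
      have hle : ∑ z ∈ ({j, k} : Finset ι), adjEntry A i z ≤ ∑ z ∈ C, adjEntry A i z :=
        Finset.sum_le_sum_of_subset_of_nonneg hsub fun z _ _ => by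
          unfold adjEntry; split_ifs <;> norm_num
      rw [Finset.sum_pair hjk] at hle
      simp only [adjEntry, hji.symm, hki.symm, hij, hik, ne_eq, not_false_eq_true, and_self,
        if_true] at hle
      unfold adjEntry at hdeg
      simp only [ne_eq] at hdeg
      linarith
    have h1 := neg_entry_nonneg hA hki.symm
    have h2 := neg_entry_nonneg hA hki
    have hik' : (A i k : ℝ) ≠ 0 := by exact_mod_cast hik
    have hki' : (A k i : ℝ) ≠ 0 := by exact_mod_cast fun e => hik ((hA.zero_iff i k).2 e)
    have key : ∀ j ∈ C, j ≠ i →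
        ε k * (A i k / A k i : ℝ) * A j i = ε j * A i j := by
      intro j hj hji
      by_cases hjk : j = k
      · subst hjk
        field_simp
      · have h0 := huniq j (Finset.mem_erase.2 ⟨hji, hj⟩) hjk
        simp [h0, (hA.zero_iff i j).1 h0]
    -- Inside `C` the vertex `i` has `k` as its only neighbour, so the edge to `k` is the only
    -- constraint on the new weight, and it dictates this value.
    refine ⟨Function.update ε i (ε k * (A i k / A k i : ℝ)), fun j => ?_, fun a ha b hb => ?_⟩
    · by_cases hji : j = i
      · subst hji
        rw [Function.update_self]
        refine mul_pos (hε k) ?_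
        rw [← neg_div_neg_eq]
        exact div_pos (lt_of_le_of_ne h1 (neg_ne_zero.2 hik').symm)
          (lt_of_le_of_ne h2 (neg_ne_zero.2 hki').symm)
      · rw [Function.update_of_ne hji]
        exact hε j
    · by_cases hai : a = i <;> by_cases hbi : b = i
      · rw [hai, hbi]
      · subst hai
        rw [Function.update_self, Function.update_of_ne hbi]
        exact key b hb hbi
      · subst hbi
        rw [Function.update_self, Function.update_of_ne hai]
        exact (key a ha hai).symm
      · rw [Function.update_of_ne hai, Function.update_of_ne hbi]
        exact h a (Finset.mem_erase.2 ⟨hai, ha⟩) b (Finset.mem_erase.2 ⟨hbi, hb⟩)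
  · push Not at hn
    refine ⟨ε, hε, fun a ha b hb => ?_⟩
    by_cases hai : a = i <;> by_cases hbi : b = i
    · rw [hai, hbi]
    · have h0 := hn b (Finset.mem_erase.2 ⟨hbi, hb⟩)
      subst hai
      simp [h0, (hA.zero_iff a b).1 h0]
    · have h0 := hn a (Finset.mem_erase.2 ⟨hai, ha⟩)
      subst hbi
      simp [h0, (hA.zero_iff b a).1 h0]
    · exact h a (Finset.mem_erase.2 ⟨hai, ha⟩) b (Finset.mem_erase.2 ⟨hbi, hb⟩)

variable [Fintype ι]

include hA in
/-- Row form of the null vector relation, with the diagonal term isolated. -/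
theorem sum_erase_eq_two_mul {u : ι → ℝ}
    (hu : (A.map (Int.cast : ℤ → ℝ)).mulVec u = 0) (i : ι) :
    ∑ j ∈ Finset.univ.erase i, -(A i j : ℝ) * u j = 2 * u i := by
  have h := congrFun hu i
  simp only [Matrix.mulVec, dotProduct, Matrix.map_apply, Pi.zero_apply] at h
  rw [← Finset.add_sum_erase _ _ (Finset.mem_univ i), hA.diag] at h
  simp only [neg_mul, Finset.sum_neg_distrib]
  push_cast at h
  linarith

include hA hpos in
theorem sum_normEntry (hu : (A.map (Int.cast : ℤ → ℝ)).mulVec u = 0) (i : ι) :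
    ∑ j, normEntry A u i j = 2 := by
  rw [← Finset.add_sum_erase _ _ (Finset.mem_univ i)]
  have h : ∀ j ∈ Finset.univ.erase i, normEntry A u i j = -(A i j : ℝ) * u j / u i := by
    intro j hj
    simp [normEntry, (Finset.ne_of_mem_erase hj).symm]
  rw [Finset.sum_congr rfl h, ← Finset.sum_div, sum_erase_eq_two_mul hA hu]
  have := (hpos i).ne'
  simp [normEntry]
  field_simp

include hA hpos in
/-- If every vertex of some non-empty set `C` has at least two neighbours in `C`, the normalized
entries are symmetric. -/
theorem normEntry_symm_of_cycle (hind : IsIndecomposable A)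
    (hu : (A.map (Int.cast : ℤ → ℝ)).mulVec u = 0) {C : Finset ι} (hC : C.Nonempty)
    (hdeg : ∀ i ∈ C, 2 ≤ ∑ j ∈ C, adjEntry A i j) (i j : ι) :
    normEntry A u i j = normEntry A u j i := by
  have hrow : ∀ i ∈ C, ∑ j ∈ C, normEntry A u i j ≤ 2 := fun i _ => by
    rw [← sum_normEntry hA hpos hu i]
    exact Finset.sum_le_sum_of_subset_of_nonneg (Finset.subset_univ _)
      fun j _ _ => normEntry_nonneg hA hpos i j
  -- The summands on the left are nonnegative by AM–GM, whereas the right side is nonpositive, since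
  -- rows sum to at most $2$ and degrees in `C` are at least $2$. So every inequality is an
  -- equality.
  have hsymm : ∑ i ∈ C, ∑ j ∈ C, (normEntry A u i j + normEntry A u j i - 2 * adjEntry A i j)
      = 2 * ∑ i ∈ C, ((∑ j ∈ C, normEntry A u i j) - ∑ j ∈ C, adjEntry A i j) := by
    simp only [Finset.sum_sub_distrib, Finset.sum_add_distrib, ← Finset.mul_sum]
    rw [Finset.sum_comm (f := fun i j => normEntry A u j i)]
    ring
  have hterm : ∀ i ∈ C, (∑ j ∈ C, normEntry A u i j) - ∑ j ∈ C, adjEntry A i j ≤ 0 :=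
    fun i hi => by linarith [hrow i hi, hdeg i hi]
  have hn : ∀ i ∈ C, ∀ j ∈ C,
      0 ≤ normEntry A u i j + normEntry A u j i - 2 * adjEntry A i j :=
    fun i _ j _ => by linarith [two_mul_adjEntry_le hA hpos i j]
  have hzero : ∑ i ∈ C, ∑ j ∈ C,
      (normEntry A u i j + normEntry A u j i - 2 * adjEntry A i j) = 0 := by
    refine le_antisymm ?_ (Finset.sum_nonneg fun i hi => Finset.sum_nonneg (hn i hi))
    rw [hsymm]
    linarith [Finset.sum_nonpos hterm]
  have hedge : ∀ i ∈ C, ∀ j ∈ C,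
      normEntry A u i j + normEntry A u j i - 2 * adjEntry A i j = 0 := fun i hi j hj =>
    (Finset.sum_eq_zero_iff_of_nonneg (hn i hi)).1
      ((Finset.sum_eq_zero_iff_of_nonneg fun i hi => Finset.sum_nonneg (hn i hi)).1 hzero i hi) j hj
  have hrow' : ∀ i ∈ C, ∑ j ∈ C, normEntry A u i j = 2 := fun i hi => by
    have h : ∑ i ∈ C, ((∑ j ∈ C, normEntry A u i j) - ∑ j ∈ C, adjEntry A i j) = 0 := by
      linarith
    have := (Finset.sum_eq_zero_iff_of_nonpos hterm).1 h i hi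
    linarith [hrow i hi, hdeg i hi]
  -- The entries inside `C` already use up the full row sum $2$, so no edge leaves `C`.
  have huniv : ∀ k, k ∈ C := hind.eq_univ hA hC fun i hi k hk => by
    have h1 := sum_normEntry hA hpos hu i
    rw [← Finset.sum_add_sum_compl C, hrow' i hi] at h1
    have h2 : ∑ j ∈ Cᶜ, normEntry A u i j = 0 := by linarith
    have h3 := (Finset.sum_eq_zero_iff_of_nonneg
      fun j _ => normEntry_nonneg hA hpos i j).1 h2 k (by simpa using hk)
    have hik : i ≠ k := fun e => hk (e ▸ hi)
    simpa [normEntry, hik, (hpos i).ne', (hpos k).ne'] using h3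
  have h := hedge i (huniv i) j (huniv j)
  by_cases hij : i ≠ j ∧ A i j ≠ 0
  · have h3 := one_le_entry_mul_entry hA hij.1 hij.2
    rw [← normEntry_mul hpos hij.1] at h3
    simp only [adjEntry, hij, ne_eq, not_false_eq_true, and_self, if_true] at h
    nlinarith [sq_nonneg (normEntry A u i j - normEntry A u j i)]
  · simp only [adjEntry, hij, if_false] at h
    linarith [normEntry_nonneg hA hpos i j, normEntry_nonneg hA hpos j i]

end Cycle

variable [Fintype ι]

/-- An indecomposable affine matrix is symmetrizable. -/
theorem IsAffine.symmetrizable (hA : IsKacMoodyMatrix A) (hind : IsIndecomposable A)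
    {u : ι → ℝ} (hpos : ∀ i, 0 < u i) (hu : (A.map (Int.cast : ℤ → ℝ)).mulVec u = 0) :
    ∃ ε : ι → ℝ, (∀ i, 0 < ε i) ∧ ∀ i j, ε i * A j i = ε j * A i j := by
  classical
  -- Either the diagram contains a cycle, and equality in AM–GM gives $a_{i,j}u_j^2=a_{j,i}u_i^2$,
  -- or it is a forest, and the weights are built leaf by leaf.
  by_cases h : ∃ C : Finset ι, C.Nonempty ∧ ∀ i ∈ C, 2 ≤ ∑ j ∈ C, adjEntry A i j
  · obtain ⟨C, hC, hdeg⟩ := h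
    refine ⟨fun i => u i ^ 2, fun i => pow_pos (hpos i) 2, fun i j => ?_⟩
    have h := normEntry_symm_of_cycle hA hpos hind hu hC hdeg i j
    by_cases hij : i = j
    · rw [hij]
    · have h1 := (hpos i).ne'
      have h2 := (hpos j).ne'
      simp only [normEntry, hij, Ne.symm hij, if_false] at h
      field_simp at h
      linarith
  · push Not at h
    obtain ⟨ε, hε, h⟩ := symmetrizable_of_leaf hA h Finset.univ
    exact ⟨ε, hε, fun i j => h i (Finset.mem_univ i) j (Finset.mem_univ j)⟩

/-- The invariant quadratic form, on the coordinates in the basis of simple coroots. -/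
noncomputable def quadForm (A : Matrix ι ι ℤ) (ε : ι → ℝ) (x : ι → ℤ) : ℝ :=
  ∑ i, ∑ j, ε i * A j i * x i * x j

/-- The symmetric matrix $B_{ij}=\varepsilon_i a_{j,i}$ has nonpositive off-diagonal entries and the
positive null vector $t_i=u_i/\varepsilon_i$. Hence the form equals
$-\frac12\sum_{i,j}B_{ij}t_it_j(x_i/t_i-x_j/t_j)^2$. The proof bounds it below term by term by
expressions whose total vanishes. -/
theorem quadForm_nonneg (hA : IsKacMoodyMatrix A) {u ε : ι → ℝ} (hpos : ∀ i, 0 < u i)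
    (hu : (A.map (Int.cast : ℤ → ℝ)).mulVec u = 0) (hε : ∀ i, 0 < ε i)
    (hs : ∀ i j, ε i * A j i = ε j * A i j) (x : ι → ℤ) : 0 ≤ quadForm A ε x := by
  let t : ι → ℝ := fun i => u i / ε i
  have ht : ∀ i, 0 < t i := fun i => div_pos (hpos i) (hε i)
  have hB : ∀ i, ∑ j, ε i * A j i * t j = 0 := fun i => by
    have h := congrFun hu i
    simp only [Matrix.mulVec, dotProduct, Matrix.map_apply, Pi.zero_apply] at h
    rw [← h]
    refine Finset.sum_congr rfl fun j _ => ?_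
    have := (hε j).ne'
    rw [hs i j]
    simp only [t]
    field_simp
  have hterm : ∀ i j, (x i : ℝ) ^ 2 / t i * (ε i * A j i * t j) / 2 +
      (x j : ℝ) ^ 2 / t j * (ε j * A i j * t i) / 2 ≤ ε i * A j i * x i * x j := by
    intro i j
    have h1 := ht i
    have h2 := ht j
    rw [← hs i j]
    by_cases hij : i = j
    · subst hij
      apply le_of_eq
      field_simp
      ring
    · have hn := mul_nonneg (hε i).le (neg_entry_nonneg hA (Ne.symm hij))
      have hsq := mul_nonneg hn (div_nonneg (sq_nonneg ((x i : ℝ) * t j - x j * t i))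
        (mul_pos h1 h2).le)
      have e : ε i * -(A j i : ℝ) * (((x i : ℝ) * t j - x j * t i) ^ 2 / (t i * t j)) =
          2 * (ε i * A j i * x i * x j) - ((x i : ℝ) ^ 2 / t i * (ε i * A j i * t j) +
            (x j : ℝ) ^ 2 / t j * (ε i * A j i * t i)) := by
        field_simp
        ring
      linarith
  have hsum : ∑ i, ∑ j, ((x i : ℝ) ^ 2 / t i * (ε i * A j i * t j) / 2 +
      (x j : ℝ) ^ 2 / t j * (ε j * A i j * t i) / 2) = 0 := by
    have h1 : ∑ i, ∑ j, (x i : ℝ) ^ 2 / t i * (ε i * A j i * t j) / 2 = 0 :=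
      Finset.sum_eq_zero fun i _ => by
        rw [← Finset.sum_div, ← Finset.mul_sum, hB]
        simp
    simp only [Finset.sum_add_distrib]
    rw [Finset.sum_comm (f := fun i j => (x j : ℝ) ^ 2 / t j * (ε j * A i j * t i) / 2), h1]
    simp
  rw [← hsum]
  exact Finset.sum_le_sum fun i _ => Finset.sum_le_sum fun j _ => hterm i j

end Combinatorics

/-! ### Climbing towards the dominant chamber: termination and confluence. -/

section Climbing

variable {ι : Type*} [Fintype ι] [DecidableEq ι]

/-- The value of the `i`-th simple root at `λ + ∑ x_j α_j^∨`, where `l i = α_i(λ)`. -/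
def label (A : Matrix ι ι ℤ) (l x : ι → ℤ) (i : ι) : ℤ := l i + ∑ j, x j * A j i

/-- The `i`-th simple reflection, on the coordinates `x` of `λ + ∑ x_j α_j^∨`. -/
def reflect (A : Matrix ι ι ℤ) (l : ι → ℤ) (i : ι) (x : ι → ℤ) : ι → ℤ :=
  x - Pi.single i (label A l x i)

/-- Reflection in a simple root that takes a negative value. -/
def Climb (A : Matrix ι ι ℤ) (l x y : ι → ℤ) : Prop :=
  ∃ i, label A l x i < 0 ∧ y = reflect A l i x

variable {A : Matrix ι ι ℤ} {l : ι → ℤ}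

theorem label_add_single (x : ι → ℤ) (i k : ι) (p : ℤ) :
    label A l (x + Pi.single i p) k = label A l x k + p * A i k := by
  simp [label, add_mul, Finset.sum_add_distrib, Pi.single_apply, add_assoc]

theorem reflect_eq_add_single (x : ι → ℤ) (i : ι) :
    reflect A l i x = x + Pi.single i (-label A l x i) := by
  rw [reflect, Pi.single_neg, sub_eq_add_neg]

theorem reflect_reflect (hA : IsKacMoodyMatrix A) (x : ι → ℤ) (i : ι) :
    reflect A l i (reflect A l i x) = x := by
  rw [reflect_eq_add_single, reflect_eq_add_single, label_add_single, hA.diag, add_assoc,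
    ← Pi.single_add]
  ring_nf
  simp

theorem Climb.le {x y : ι → ℤ} (h : Climb A l x y) : x ≤ y := by
  obtain ⟨i, hi, rfl⟩ := h
  rw [reflect_eq_add_single]
  refine le_add_of_nonneg_right ?_
  rw [Pi.single_nonneg]
  omega

theorem le_of_reflTransGen_climb {x y : ι → ℤ} (h : Relation.ReflTransGen (Climb A l) x y) :
    x ≤ y := by
  induction h with
  | refl => exact le_rfl
  | tail _ h ih => exact ih.trans h.le

theorem quadForm_add_single (hA : IsKacMoodyMatrix A) {ε : ι → ℝ}
    (hs : ∀ i j, ε i * A j i = ε j * A i j) (x : ι → ℤ) (i : ι) (p : ℤ) :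
    quadForm A ε (x + Pi.single i p) =
      quadForm A ε x + 2 * p * ε i * ∑ j, (x j : ℝ) * A j i + 2 * ε i * p ^ 2 := by
  have h1 : ∀ a, ∑ b, ε a * A b a * (x a : ℝ) * ((Pi.single i p : ι → ℤ) b : ℝ) =
      ε i * p * (x a * A a i) := fun a => by
    rw [Finset.sum_eq_single i]
    · simp only [Pi.single_eq_same]
      linear_combination (x a * p : ℝ) * hs a i
    · intro b _ hb
      simp [Pi.single_eq_of_ne hb]
    · simp
  have h2 : ∑ a, ∑ b, ε a * A b a * ((Pi.single i p : ι → ℤ) a : ℝ) * (x b : ℝ) =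
      ε i * p * ∑ b, (x b : ℝ) * A b i := by
    rw [Finset.sum_eq_single i]
    · simp only [Pi.single_eq_same, Finset.mul_sum]
      exact Finset.sum_congr rfl fun b _ => by ring
    · intro b _ hb
      simp [Pi.single_eq_of_ne hb]
    · simp
  have h3 : ∑ a, ∑ b, ε a * A b a * ((Pi.single i p : ι → ℤ) a : ℝ) *
      ((Pi.single i p : ι → ℤ) b : ℝ) = 2 * ε i * p ^ 2 := by
    rw [Finset.sum_eq_single i]
    · rw [Finset.sum_eq_single i]
      · simp only [Pi.single_eq_same, hA.diag]
        push_cast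
        ring
      · intro b _ hb
        simp [Pi.single_eq_of_ne hb]
      · simp
    · intro b _ hb
      simp [Pi.single_eq_of_ne hb]
    · simp
  simp only [quadForm, Pi.add_apply, Int.cast_add, mul_add, add_mul, Finset.sum_add_distrib,
    h1, h2, h3, ← Finset.mul_sum]
  ring

/-- With $(v,\alpha_i^\vee)=\varepsilon_i\alpha_i(v)$, the norm $|\lambda|^2+2(\lambda,x)+|x|^2$ of
$\lambda+x$ is invariant, so the change in $|x|^2$ is opposite to that in $2(\lambda,x)$. For
$\lambda$ regular dominant it is negative along a climb. -/
theorem quadForm_reflect (hA : IsKacMoodyMatrix A) {ε : ι → ℝ}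
    (hs : ∀ i j, ε i * A j i = ε j * A i j) (x : ι → ℤ) (i : ι) :
    quadForm A ε (reflect A l i x) = quadForm A ε x + 2 * ε i * label A l x i * l i := by
  rw [reflect_eq_add_single, quadForm_add_single hA hs]
  have : (label A l x i : ℝ) = l i + ∑ j, (x j : ℝ) * A j i := by
    simp [label]
  push_cast
  rw [this]
  ring

/-- Climbing terminates. -/
theorem exists_measure_climb (hA : IsKacMoodyMatrix A) (hind : IsIndecomposable A)
    {u : ι → ℝ} (hpos : ∀ i, 0 < u i) (hu : (A.map (Int.cast : ℤ → ℝ)).mulVec u = 0)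
    (hl : ∀ i, 0 < l i) :
    ∃ μ : (ι → ℤ) → ℕ, ∀ x y, Climb A l x y → μ y < μ x := by
  obtain ⟨ε, hε, hs⟩ := IsAffine.symmetrizable hA hind hpos hu
  obtain ⟨i₀⟩ := hind.1
  obtain ⟨m, hm0, hm⟩ : ∃ m : ℝ, 0 < m ∧ ∀ i, m ≤ 2 * ε i := by
    obtain ⟨i, _, hi⟩ := Finset.exists_min_image Finset.univ ε ⟨i₀, Finset.mem_univ i₀⟩
    exact ⟨ε i, hε i, fun j => by linarith [hi j (Finset.mem_univ j), hε j]⟩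
  -- A climb has label at most $-1$ and $l_i\ge 1$, so it lowers the form by at least
  -- $2\varepsilon_i\ge m$. Dividing by `m` turns this drop into at least one unit, which the floor
  -- detects.
  refine ⟨fun x => ⌊quadForm A ε x / m⌋₊, ?_⟩
  rintro x _ ⟨i, hi, rfl⟩
  have h1 : (label A l x i : ℝ) ≤ -1 := by exact_mod_cast Int.le_sub_one_of_lt hi
  have h2 : (1 : ℝ) ≤ l i := by exact_mod_cast hl i
  have h3 : quadForm A ε (reflect A l i x) ≤ quadForm A ε x - m := by
    rw [quadForm_reflect hA hs]
    have h4 : (1 : ℝ) ≤ -label A l x i * l i := by nlinarith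
    nlinarith [hm i, hε i]
  have h0 : 0 ≤ quadForm A ε (reflect A l i x) / m :=
    div_nonneg (quadForm_nonneg hA hpos hu hε hs _) hm0.le
  have h5 : quadForm A ε (reflect A l i x) / m + 1 ≤ quadForm A ε x / m := by
    rw [div_add_one hm0.ne']
    gcongr
    linarith
  calc ⌊quadForm A ε (reflect A l i x) / m⌋₊
      < ⌊quadForm A ε (reflect A l i x) / m + 1⌋₊ := by
        rw [Nat.floor_add_one h0]; exact Nat.lt_succ_self _
    _ ≤ _ := Nat.floor_le_floor h5

theorem exists_reflTransGen_climb {μ : (ι → ℤ) → ℕ} (hμ : ∀ x y, Climb A l x y → μ y < μ x)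
    (x : ι → ℤ) :
    ∃ y, Relation.ReflTransGen (Climb A l) x y ∧ ∀ i, 0 ≤ label A l y i := by
  induction hn : μ x using Nat.strong_induction_on generalizing x with
  | _ n ih =>
  by_cases h : ∀ i, 0 ≤ label A l x i
  · exact ⟨x, .refl, h⟩
  · push Not at h
    obtain ⟨i, hi⟩ := h
    have hc : Climb A l x (reflect A l i x) := ⟨i, hi, rfl⟩
    obtain ⟨y, hy, hd⟩ := ih _ (hn ▸ hμ _ _ hc) _ rfl
    exact ⟨y, .head hc hy, hd⟩

omit [DecidableEq ι] in
/-- The level, i.e. the value of the imaginary root, is constant. -/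
theorem sum_mul_label {u : ι → ℝ} (hu : (A.map (Int.cast : ℤ → ℝ)).mulVec u = 0) (x : ι → ℤ) :
    ∑ i, u i * label A l x i = ∑ i, u i * l i := by
  have h : ∀ j, ∑ i, (A j i : ℝ) * u i = 0 := fun j => by
    have h := congrFun hu j
    simpa only [Matrix.mulVec, dotProduct, Matrix.map_apply, Pi.zero_apply] using h
  have h2 : ∑ i, ∑ j, u i * ((x j : ℝ) * A j i) = 0 := by
    rw [Finset.sum_comm]
    refine Finset.sum_eq_zero fun j _ => ?_
    calc ∑ i, u i * ((x j : ℝ) * A j i) = x j * ∑ i, (A j i : ℝ) * u i := by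
          rw [Finset.mul_sum]
          exact Finset.sum_congr rfl fun i _ => by ring
      _ = 0 := by rw [h, mul_zero]
  simp only [label, Int.cast_add, Int.cast_sum, Int.cast_mul, mul_add, Finset.sum_add_distrib,
    Finset.mul_sum, h2, add_zero]

/-- Two simple roots which are negative at a point of positive level span a root system of
finite type. -/
theorem entry_mul_entry_le_three (hA : IsKacMoodyMatrix A) (hind : IsIndecomposable A)
    {u : ι → ℝ} (hpos : ∀ i, 0 < u i) (hu : (A.map (Int.cast : ℤ → ℝ)).mulVec u = 0)
    (hl : ∀ i, 0 < l i) {x : ι → ℤ} {i j : ι} (hij : i ≠ j) (hi : label A l x i < 0)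
    (hj : label A l x j < 0) : A i j * A j i ≤ 3 := by
  by_contra hlt
  have h4 : (4 : ℝ) ≤ (A i j : ℝ) * A j i := by exact_mod_cast not_le.1 hlt
  have aux : ∀ {i j : ι}, i ≠ j → ∑ k ∈ (Finset.univ.erase i).erase j, -(A i k : ℝ) * u k =
      2 * u i + A i j * u j := fun {i j} h => by
    have h1 := sum_erase_eq_two_mul hA hu i
    rw [← Finset.add_sum_erase _ _ (Finset.mem_erase.2 ⟨h.symm, Finset.mem_univ j⟩)] at h1
    linarith
  have hnn : ∀ i j : ι, ∀ k ∈ (Finset.univ.erase i).erase j, 0 ≤ -(A i k : ℝ) * u k :=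
    fun i j k hk => mul_nonneg (neg_entry_nonneg hA
      (Finset.ne_of_mem_erase (Finset.mem_of_mem_erase hk)).symm) (hpos k).le
  have h1 := Finset.sum_nonneg (hnn i j)
  have h2 := Finset.sum_nonneg (hnn j i)
  have e1 := aux hij
  have e2 := aux hij.symm
  have n1 := neg_entry_nonneg hA hij
  have n2 := neg_entry_nonneg hA hij.symm
  have pi := hpos i
  have pj := hpos j
  -- Rows $i$ and $j$ of $Au=0$ give $|a_{i,j}|u_j\le 2u_i$ and $|a_{j,i}|u_i\le 2u_j$. Their
  -- product gives $a_{i,j}a_{j,i}\le 4$, so the assumed bound `h4` forces equality in both. Then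
  -- neither index has a further neighbour, the diagram is $\{i,j\}$, and two negative labels
  -- contradict the positive level.
  have z1 : 2 * u i + A i j * u j = 0 := by
    rw [e1] at h1
    rw [e2] at h2
    nlinarith [mul_nonneg n1 h2]
  have z2 : 2 * u j + A j i * u i = 0 := by
    rw [e1] at h1
    rw [e2] at h2
    nlinarith [mul_nonneg n2 h1]
  have key : ∀ {i j k : ι}, 2 * u i + A i j * u j = 0 → i ≠ j → k ≠ i → k ≠ j → A i k = 0 := by
    intro i j k hz hij hki hkj
    have h := (Finset.sum_eq_zero_iff_of_nonneg (hnn i j)).1 ((aux hij).trans hz) k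
      (by simp [hki, hkj])
    simpa [(hpos k).ne'] using h
  have huniv := hind.eq_univ hA (C := {i, j}) ⟨i, by simp⟩ (by
    intro a ha k hk
    simp only [Finset.mem_insert, Finset.mem_singleton, not_or] at ha hk
    rcases ha with rfl | rfl
    · exact key z1 hij hk.1 hk.2
    · exact key z2 hij.symm hk.2 hk.1)
  have hlev := sum_mul_label (l := l) hu x
  have hneg : ∑ k, u k * (label A l x k : ℝ) < 0 := by
    refine Finset.sum_neg (fun k _ => mul_neg_of_pos_of_neg (hpos k) ?_) ⟨i, Finset.mem_univ i⟩
    have := huniv k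
    simp only [Finset.mem_insert, Finset.mem_singleton] at this
    rcases this with rfl | rfl
    · exact_mod_cast hi
    · exact_mod_cast hj
  have hp : 0 ≤ ∑ k, u k * (l k : ℝ) :=
    Finset.sum_nonneg fun k _ => mul_nonneg (hpos k).le (by exact_mod_cast (hl k).le)
  linarith

/-- At these coordinates the label at `i` is $2p-a-tq$: `hlt` says that it is negative, and
reflecting replaces $p$ by $a-p+tq$. Keeping `p'` as a separate argument lets chains of climbs be
written with simplified coefficients. -/
theorem climb_rank_two_left (hA : IsKacMoodyMatrix A) {i j : ι} {x z : ι → ℤ} {a t : ℤ}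
    (ha : label A l x i = -a) (ht : A j i = -t) {p q : ℤ} (p' : ℤ)
    (hlt : 2 * p < a + t * q) (hp : p' = a - p + t * q)
    (h : Relation.ReflTransGen (Climb A l) (x + Pi.single i p' + Pi.single j q) z) :
    Relation.ReflTransGen (Climb A l) (x + Pi.single i p + Pi.single j q) z := by
  have hlab : label A l (x + Pi.single i p + Pi.single j q) i = -a + 2 * p - t * q := by
    rw [label_add_single, label_add_single, ha, ht, hA.diag]
    ring
  refine .head ⟨i, by rw [hlab]; linarith, ?_⟩ h
  have e : ∀ y y' z w : ι → ℤ, y' = y + w → x + y' + z = x + y + z + w := by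
    rintro y _ z w rfl
    abel
  rw [reflect_eq_add_single, hlab, hp]
  refine e _ _ _ _ ?_
  rw [← Pi.single_add]
  ring_nf

theorem climb_rank_two_right (hA : IsKacMoodyMatrix A) {i j : ι} {x z : ι → ℤ} {b s : ℤ}
    (hb : label A l x j = -b) (hs : A i j = -s) {p q : ℤ} (q' : ℤ)
    (hlt : 2 * q < b + s * p) (hq : q' = b - q + s * p)
    (h : Relation.ReflTransGen (Climb A l) (x + Pi.single i p + Pi.single j q') z) :
    Relation.ReflTransGen (Climb A l) (x + Pi.single i p + Pi.single j q) z := by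
  rw [add_right_comm] at h ⊢
  exact climb_rank_two_left hA hb hs q' hlt hq h

/-- Local confluence, for a pair of simple roots with `|a_{i,j}| ≤ |a_{j,i}|`. -/
theorem climb_locally_confluent_aux (hA : IsKacMoodyMatrix A) {i j : ι} {x : ι → ℤ}
    (hi : label A l x i < 0) (hj : label A l x j < 0) {s t : ℤ}
    (hs : A i j = -s) (ht : A j i = -t)
    (hst : s = 0 ∧ t = 0 ∨ s = 1 ∧ (t = 1 ∨ t = 2 ∨ t = 3)) :
    ∃ z, Relation.ReflTransGen (Climb A l) (reflect A l i x) z ∧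
      Relation.ReflTransGen (Climb A l) (reflect A l j x) z := by
  obtain ⟨a, ha⟩ : ∃ a, label A l x i = -a := ⟨-label A l x i, by ring⟩
  obtain ⟨b, hb⟩ : ∃ b, label A l x j = -b := ⟨-label A l x j, by ring⟩
  have ha0 : 0 < a := by omega
  have hb0 : 0 < b := by omega
  have e1 : reflect A l i x = x + Pi.single i a + Pi.single j 0 := by
    rw [reflect_eq_add_single, ha, neg_neg, Pi.single_zero, add_zero]
  have e2 : reflect A l j x = x + Pi.single i 0 + Pi.single j b := by
    rw [reflect_eq_add_single, hb, neg_neg, Pi.single_zero, add_zero]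
  rw [e1, e2]
  -- Types $A_1\times A_1$, $A_2$, $B_2$, $G_2$. Counting the reflection already made, both paths
  -- are the alternating words of length $2,3,4,6$ for the longest element of the dihedral group, so
  -- they meet. The explicit arguments are the successive coordinates along these words.
  rcases hst with ⟨rfl, rfl⟩ | ⟨rfl, rfl | rfl | rfl⟩
  · exact ⟨_, climb_rank_two_right hA hb hs b (by linarith) (by ring) .refl,
      climb_rank_two_left hA ha ht a (by linarith) (by ring) .refl⟩
  · exact ⟨_,
      climb_rank_two_right hA hb hs (a + b) (by linarith) (by ring) <|
      climb_rank_two_left hA ha ht (a + b) (by linarith) (by ring) .refl,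
      climb_rank_two_left hA ha ht (a + b) (by linarith) (by ring) <|
      climb_rank_two_right hA hb hs (a + b) (by linarith) (by ring) .refl⟩
  · exact ⟨_,
      climb_rank_two_right hA hb hs (a + b) (by linarith) (by ring) <|
      climb_rank_two_left hA ha ht (2 * a + 2 * b) (by linarith) (by ring) <|
      climb_rank_two_right hA hb hs (a + 2 * b) (by linarith) (by ring) .refl,
      climb_rank_two_left hA ha ht (a + 2 * b) (by linarith) (by ring) <|
      climb_rank_two_right hA hb hs (a + 2 * b) (by linarith) (by ring) <|
      climb_rank_two_left hA ha ht (2 * a + 2 * b) (by linarith) (by ring) .refl⟩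
  · exact ⟨_,
      climb_rank_two_right hA hb hs (a + b) (by linarith) (by ring) <|
      climb_rank_two_left hA ha ht (3 * a + 3 * b) (by linarith) (by ring) <|
      climb_rank_two_right hA hb hs (2 * a + 3 * b) (by linarith) (by ring) <|
      climb_rank_two_left hA ha ht (4 * a + 6 * b) (by linarith) (by ring) <|
      climb_rank_two_right hA hb hs (2 * a + 4 * b) (by linarith) (by ring) .refl,
      climb_rank_two_left hA ha ht (a + 3 * b) (by linarith) (by ring) <|
      climb_rank_two_right hA hb hs (a + 3 * b) (by linarith) (by ring) <|
      climb_rank_two_left hA ha ht (3 * a + 6 * b) (by linarith) (by ring) <|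
      climb_rank_two_right hA hb hs (2 * a + 4 * b) (by linarith) (by ring) <|
      climb_rank_two_left hA ha ht (4 * a + 6 * b) (by linarith) (by ring) .refl⟩

theorem climb_locally_confluent (hA : IsKacMoodyMatrix A) (hind : IsIndecomposable A)
    {u : ι → ℝ} (hpos : ∀ i, 0 < u i) (hu : (A.map (Int.cast : ℤ → ℝ)).mulVec u = 0)
    (hl : ∀ i, 0 < l i) {x y z : ι → ℤ} (hy : Climb A l x y) (hz : Climb A l x z) :
    ∃ v, Relation.ReflTransGen (Climb A l) y v ∧ Relation.ReflTransGen (Climb A l) z v := by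
  obtain ⟨i, hi, rfl⟩ := hy
  obtain ⟨j, hj, rfl⟩ := hz
  by_cases hij : i = j
  · subst hij
    exact ⟨_, .refl, .refl⟩
  have h3 := entry_mul_entry_le_three hA hind hpos hu hl hij hi hj
  have n1 := hA.nonpos i j hij
  have n2 := hA.nonpos j i (Ne.symm hij)
  obtain ⟨s, hs⟩ : ∃ s, A i j = -s := ⟨-A i j, by ring⟩
  obtain ⟨t, ht⟩ : ∃ t, A j i = -t := ⟨-A j i, by ring⟩
  have hz := hA.zero_iff i j
  rw [hs, ht] at hz h3
  rw [hs] at n1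
  rw [ht] at n2
  have hst : s * t ≤ 3 := by linarith
  have hz' : s = 0 ↔ t = 0 := by simpa using hz
  -- A product at most $3$ makes one of the two entries $0$ or $-1$; exchanging `i` and `j` covers
  -- both orders.
  have hcases : (s = 0 ∧ t = 0 ∨ s = 1 ∧ (t = 1 ∨ t = 2 ∨ t = 3)) ∨
      (t = 0 ∧ s = 0 ∨ t = 1 ∧ (s = 1 ∨ s = 2 ∨ s = 3)) := by
    by_cases h0 : s = 0
    · exact Or.inl (Or.inl ⟨h0, hz'.1 h0⟩)
    · have h0' : t ≠ 0 := fun e => h0 (hz'.2 e)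
      have hs1 : 1 ≤ s := by omega
      have ht1 : 1 ≤ t := by omega
      have hs3 : s ≤ 3 := by nlinarith
      have ht3 : t ≤ 3 := by nlinarith
      interval_cases s <;> interval_cases t <;> simp_all
  rcases hcases with h | h
  · exact climb_locally_confluent_aux hA hi hj hs ht h
  · obtain ⟨v, h1, h2⟩ := climb_locally_confluent_aux hA hj hi ht hs h
    exact ⟨v, h2, h1⟩

/-- Newman's lemma, for relations with a measure. -/
theorem eq_of_locally_confluent {α : Type*} {r : α → α → Prop} (μ : α → ℕ)
    (hμ : ∀ x y, r x y → μ y < μ x)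
    (hloc : ∀ x y z, r x y → r x z →
      ∃ v, Relation.ReflTransGen r y v ∧ Relation.ReflTransGen r z v)
    (x : α) {y z : α} (hy : Relation.ReflTransGen r x y) (hz : Relation.ReflTransGen r x z)
    (hny : ∀ v, ¬ r y v) (hnz : ∀ v, ¬ r z v) : y = z := by
  have hnf : ∀ x, ∃ y, Relation.ReflTransGen r x y ∧ ∀ v, ¬ r y v := fun x => by
    induction hn : μ x using Nat.strong_induction_on generalizing x with
    | _ n ih =>
    by_cases h : ∃ v, r x v
    · obtain ⟨v, hv⟩ := h
      obtain ⟨y, hy, hd⟩ := ih _ (hn ▸ hμ _ _ hv) _ rfl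
      exact ⟨y, .head hv hy, hd⟩
    · exact ⟨x, .refl, not_exists.1 h⟩
  induction hn : μ x using Nat.strong_induction_on generalizing x y z with
  | _ n ih =>
  rcases hy.cases_head with rfl | ⟨y', hxy, hy'⟩
  · rcases hz.cases_head with rfl | ⟨z', hxz, _⟩
    · rfl
    · exact (hny _ hxz).elim
  rcases hz.cases_head with rfl | ⟨z', hxz, hz'⟩
  · exact (hnz _ hxy).elim
  obtain ⟨v, hyv, hzv⟩ := hloc _ _ _ hxy hxz
  -- A normal form of the common descendant is compared with `y` from `y'` and with `z` from `z'`,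
  -- both of smaller measure.
  obtain ⟨w, hvw, hw⟩ := hnf v
  exact (ih _ (hn ▸ hμ _ _ hxy) y' hy' (hyv.trans hvw) hny hw rfl).trans
    (ih _ (hn ▸ hμ _ _ hxz) z' (hzv.trans hvw) hz' hw hnz rfl)

/-- The set of points that climb to the origin is stable under the simple reflections. -/
theorem reflTransGen_climb_reflect (hA : IsKacMoodyMatrix A) (hind : IsIndecomposable A)
    {u : ι → ℝ} (hpos : ∀ i, 0 < u i) (hu : (A.map (Int.cast : ℤ → ℝ)).mulVec u = 0)
    (hl : ∀ i, 0 < l i) {x : ι → ℤ} (hx : Relation.ReflTransGen (Climb A l) x 0) (i : ι) :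
    Relation.ReflTransGen (Climb A l) (reflect A l i x) 0 := by
  rcases lt_trichotomy (label A l x i) 0 with h | h | h
  · obtain ⟨μ, hμ⟩ := exists_measure_climb hA hind hpos hu hl
    obtain ⟨y, hy, hd⟩ := exists_reflTransGen_climb hμ (reflect A l i x)
    have hc : Climb A l x (reflect A l i x) := ⟨i, h, rfl⟩
    -- The reflection is itself a climb from `x`, so `y` is a normal form of `x`. The origin is
    -- another one, as all its labels `l k` are positive.
    have h0 : y = 0 := by
      refine eq_of_locally_confluent μ hμ
        (fun x y z => climb_locally_confluent hA hind hpos hu hl) x (.head hc hy) hx ?_ ?_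
      · rintro v ⟨k, hk, _⟩
        exact absurd (hd k) (not_le.2 hk)
      · rintro v ⟨k, hk, _⟩
        have := hl k
        simp only [label, Pi.zero_apply, zero_mul, Finset.sum_const_zero, add_zero] at hk
        omega
    rwa [h0] at hy
  · rwa [reflect, h, Pi.single_zero, sub_zero]
  · refine .head ⟨i, ?_, (reflect_reflect hA x i).symm⟩ hx
    rw [reflect_eq_add_single, label_add_single, hA.diag]
    linarith

end Climbing

/-! ### Integral linear forms on a lattice. -/

/-- A linearly independent family in a lattice has a common positive value under some integral
linear form. -/
theorem exists_dual_eq_const {ι M : Type*} [AddCommGroup M] [Module.Free ℤ M]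
    [Module.Finite ℤ M] {v : ι → M} (hv : LinearIndependent ℤ v) :
    ∃ (f : M →ₗ[ℤ] ℤ) (N : ℤ), 0 < N ∧ ∀ i, f (v i) = N := by
  let b := Module.Free.chooseBasis ℤ M
  let e : M →ₗ[ℤ] (Module.Free.ChooseBasisIndex ℤ M → ℚ) :=
    LinearMap.pi fun k => (Algebra.linearMap ℤ ℚ) ∘ₗ b.coord k
  have he : LinearMap.ker e = ⊥ := by
    rw [LinearMap.ker_eq_bot']
    intro x hx
    refine b.ext_elem fun k => ?_
    simpa [e] using congrFun hx k
  have hv' : LinearIndependent ℚ (e ∘ v) :=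
    (LinearIndependent.iff_fractionRing (R := ℤ) (K := ℚ)).1 (hv.map' e he)
  obtain ⟨g, hg⟩ := LinearMap.exists_extend ((Module.Basis.span hv').constr ℚ fun _ => (1 : ℚ))
  have hg1 : ∀ i, g (e (v i)) = 1 := fun i => by
    have h := LinearMap.congr_fun hg (Module.Basis.span hv' i)
    rw [Module.Basis.constr_basis] at h
    rw [← h, LinearMap.comp_apply, Submodule.subtype_apply, Module.Basis.span_apply]
    rfl
  obtain ⟨d, hd⟩ := IsLocalization.exist_integer_multiples_of_finite (nonZeroDivisors ℤ)
    fun k => g (e (b k))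
  choose z hz using hd
  have key : (Algebra.linearMap ℤ ℚ) ∘ₗ b.constr ℤ z =
      ((d : ℤ) : ℤ) • ((g.restrictScalars ℤ) ∘ₗ e) := by
    refine b.ext fun k => ?_
    simpa using hz k
  -- Clearing denominators gives the common value `d`, of unknown sign; a second factor `d` makes it
  -- the positive number $d^2$.
  refine ⟨(d : ℤ) • b.constr ℤ z, d * d, mul_self_pos.2 (nonZeroDivisors.ne_zero d.2), fun i => ?_⟩
  have h := LinearMap.congr_fun key (v i)
  have h2 : ((b.constr ℤ z (v i) : ℤ) : ℚ) = (d : ℤ) := by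
    simpa [hg1] using h
  have h3 : b.constr ℤ z (v i) = (d : ℤ) := by exact_mod_cast h2
  simp [h3]

/-! ### The Weyl group action on cocharacters and on translates by coroots. -/

namespace RootDatum

variable {ι X Y : Type*} [AddCommGroup X] [Module.Free ℤ X] [Module.Finite ℤ X]
  [AddCommGroup Y] [Module.Free ℤ Y] [Module.Finite ℤ Y] (D : RootDatum ι X Y)

theorem simpleRoot_simpleCoroot_eq (i j : ι) :
    D.simpleRoot j (D.simpleCoroot i) = D.A i j := by
  simp [simpleRoot, simpleCoroot, charForm_tmul, D.matrix_eq]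

theorem simpleCoroot_mem_cochar (i : ι) : D.simpleCoroot i ∈ D.cochar := ⟨D.coroot i, rfl⟩

theorem simpleReflection_mem (i : ι) : D.simpleReflection i ∈ D.weylGroup :=
  Subgroup.subset_closure ⟨i, rfl⟩

/-- Sets which are stable under the simple reflections are stable under the Weyl group. -/
theorem weylGroup_stable {S : Set D.Apartment} (hS : ∀ i, ∀ v ∈ S, D.simpleReflection i v ∈ S)
    {w : D.Apartment ≃ₗ[ℝ] D.Apartment} (hw : w ∈ D.weylGroup) {v : D.Apartment} (hv : v ∈ S) :
    w v ∈ S := by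
  induction hw using Subgroup.closure_induction_left with
  | one => exact hv
  | mul_left x hx y _ h =>
    obtain ⟨i, rfl⟩ := hx
    exact hS i _ h
  | inv_mul_cancel x hx y _ h =>
    obtain ⟨i, rfl⟩ := hx
    have e : (D.simpleReflection i)⁻¹ = D.simpleReflection i :=
      inv_eq_of_mul_eq_one_left <| LinearEquiv.ext fun v => by
        rw [LinearEquiv.mul_apply]
        exact Module.involutive_reflection (D.simpleRoot_simpleCoroot i) v
    rw [e]
    exact hS i _ h

theorem exists_int_simpleRoot {v : D.Apartment} (hv : v ∈ D.cochar) (i : ι) :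
    ∃ n : ℤ, D.simpleRoot i v = n := by
  obtain ⟨y, rfl⟩ := hv
  exact ⟨D.pairing (D.root i) y, by
    change D.charForm (D.root i) ((1 : ℝ) ⊗ₜ[ℤ] y) = _
    rw [charForm_tmul, mul_one]⟩

theorem weylGroup_mem_cochar {w : D.Apartment ≃ₗ[ℝ] D.Apartment} (hw : w ∈ D.weylGroup)
    {v : D.Apartment} (hv : v ∈ D.cochar) : w v ∈ D.cochar := by
  refine D.weylGroup_stable (S := D.cochar) (fun i v hv => ?_) hw hv
  obtain ⟨n, hn⟩ := D.exists_int_simpleRoot hv i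
  rw [simpleReflection_apply, hn, Int.cast_smul_eq_zsmul]
  exact D.cochar.sub_mem hv (D.cochar.zsmul_mem (D.simpleCoroot_mem_cochar i) n)

/-- There are regular dominant cocharacters. -/
theorem exists_mem_cochar_chamber : ∃ l, l ∈ (D.cochar : Set D.Apartment) ∩ D.chamber := by
  obtain ⟨f, N, hN, hf⟩ := exists_dual_eq_const D.linearIndependent_root
  have := D.isPerfPair
  refine ⟨(1 : ℝ) ⊗ₜ[ℤ] D.pairing.flip.toPerfPair.symm f, ⟨_, rfl⟩, fun i => ?_⟩
  rw [simpleRoot, charForm_tmul, LinearMap.apply_toPerfPair_flip, hf, mul_one]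
  exact_mod_cast hN

/-- There is a linear form, integral on `Y`, which takes the same positive value at all simple
coroots. -/
theorem exists_height : ∃ (h : D.Apartment →ₗ[ℝ] ℝ) (N : ℝ), 0 < N ∧
    (∀ i, h (D.simpleCoroot i) = N) ∧ ∀ v ∈ D.cochar, ∃ n : ℤ, h v = n := by
  obtain ⟨f, N, hN, hf⟩ := exists_dual_eq_const D.linearIndependent_coroot
  have key : ∀ y, ((TensorProduct.AlgebraTensorModule.rid ℤ ℝ ℝ).toLinearMap ∘ₗ f.baseChange ℝ)
      ((1 : ℝ) ⊗ₜ[ℤ] y) = f y := fun y => by simp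
  refine ⟨(TensorProduct.AlgebraTensorModule.rid ℤ ℝ ℝ).toLinearMap ∘ₗ f.baseChange ℝ, N,
    by exact_mod_cast hN, fun i => ?_, ?_⟩
  · rw [simpleCoroot, key, hf]
  · rintro _ ⟨y, rfl⟩
    exact ⟨f y, key y⟩

variable [Fintype ι]

/-- The point `v + ∑ x_i α_i^∨`. -/
def translate (v : D.Apartment) (x : ι → ℤ) : D.Apartment :=
  v + ∑ i, x i • D.simpleCoroot i

theorem translate_zero (v : D.Apartment) : D.translate v 0 = v := by simp [translate]

theorem translate_single [DecidableEq ι] (v : D.Apartment) (i : ι) (n : ℤ) :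
    D.translate v (Pi.single i n) = v + n • D.simpleCoroot i := by
  rw [translate, Finset.sum_eq_single i]
  · simp
  · intro j _ hj
    simp [Pi.single_eq_of_ne hj]
  · simp

theorem translate_add (v : D.Apartment) (x y : ι → ℤ) :
    D.translate v (x + y) = D.translate (D.translate v x) y := by
  simp [translate, add_smul, Finset.sum_add_distrib, add_assoc]

theorem simpleRoot_translate {v : D.Apartment} {l : ι → ℤ} (hl : ∀ i, D.simpleRoot i v = l i)
    (x : ι → ℤ) (i : ι) : D.simpleRoot i (D.translate v x) = label D.A l x i := by
  simp [translate, label, hl, simpleRoot_simpleCoroot_eq]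

theorem simpleReflection_translate [DecidableEq ι] {v : D.Apartment} {l : ι → ℤ}
    (hl : ∀ i, D.simpleRoot i v = l i) (x : ι → ℤ) (i : ι) :
    D.simpleReflection i (D.translate v x) = D.translate v (reflect D.A l i x) := by
  rw [simpleReflection_apply, simpleRoot_translate D hl, reflect_eq_add_single, translate_add,
    translate_single, Int.cast_smul_eq_zsmul, neg_smul, sub_eq_add_neg]

theorem sum_zsmul_mem_corootCone {x : ι → ℤ} (hx : 0 ≤ x) :
    ∑ i, x i • D.simpleCoroot i ∈ D.corootCone := by
  refine sum_mem fun i _ => ?_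
  obtain ⟨n, hn⟩ := Int.eq_ofNat_of_zero_le (hx i)
  rw [hn, natCast_zsmul]
  exact nsmul_mem (AddSubmonoid.subset_closure (Set.mem_range_self i)) n

theorem exists_translate_of_mem_weylGroup {v : D.Apartment} (hv : v ∈ D.cochar)
    {w : D.Apartment ≃ₗ[ℝ] D.Apartment} (hw : w ∈ D.weylGroup) :
    ∃ x : ι → ℤ, w v = D.translate v x := by
  classical
  choose l hl using D.exists_int_simpleRoot hv
  have h0 : ∃ x : ι → ℤ, v = D.translate v x := ⟨0, (D.translate_zero v).symm⟩
  refine D.weylGroup_stable (S := {y | ∃ x : ι → ℤ, y = D.translate v x}) ?_ hw h0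
  rintro i _ ⟨x, rfl⟩
  exact ⟨_, D.simpleReflection_translate hl x i⟩

/-! ### Orbits of regular dominant cocharacters and heights of real coroots. -/

variable {D} (hind : IsIndecomposable D.A) (haff : IsAffine D.A)

include hind haff in
/-- A regular dominant cocharacter is the largest element of its orbit. -/
theorem sub_mem_corootCone {v : D.Apartment} (hv : v ∈ D.cochar) (hc : v ∈ D.chamber)
    {w : D.Apartment ≃ₗ[ℝ] D.Apartment} (hw : w ∈ D.weylGroup) : v - w v ∈ D.corootCone := by
  classical
  obtain ⟨u, hpos, hu⟩ := haff.exists_pos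
  choose l hl using D.exists_int_simpleRoot hv
  have hl0 : ∀ i, 0 < l i := fun i => by
    have := hc i
    rw [hl] at this
    exact_mod_cast this
  -- The translates that climb to `v` form a set stable under reflections and containing `v`, hence
  -- the whole orbit. Climbing increases coordinates, so here $x\le 0$.
  obtain ⟨x, hx, e⟩ := D.weylGroup_stable
    (S := {y | ∃ x, Relation.ReflTransGen (Climb D.A l) x 0 ∧ y = D.translate v x})
    (by
      rintro i _ ⟨x, hx, rfl⟩
      exact ⟨_, reflTransGen_climb_reflect D.isKacMoodyMatrix hind hpos hu hl0 hx i,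
        D.simpleReflection_translate hl x i⟩) hw
    (v := v) ⟨0, .refl, (D.translate_zero v).symm⟩
  have h := D.sum_zsmul_mem_corootCone (x := -x) (neg_nonneg.2 (le_of_reflTransGen_climb hx))
  rw [e, translate]
  simpa using h

include hind haff in
/-- The translates of a regular dominant cocharacter by the coroot lattice lie in the Tits
cone. -/
theorem translate_mem_titsCone {v : D.Apartment} (hv : v ∈ D.cochar) (hc : v ∈ D.chamber)
    (x : ι → ℤ) : D.translate v x ∈ D.titsCone := by
  classical
  obtain ⟨u, hpos, hu⟩ := haff.exists_pos
  choose l hl using D.exists_int_simpleRoot hv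
  have hl0 : ∀ i, 0 < l i := fun i => by
    have := hc i
    rw [hl] at this
    exact_mod_cast this
  obtain ⟨μ, hμ⟩ := exists_measure_climb D.isKacMoodyMatrix hind hpos hu hl0
  obtain ⟨y, hy, hd⟩ := exists_reflTransGen_climb hμ x
  -- The climb ends at a dominant point; undoing its reflections one by one carries membership in
  -- the Tits cone back to the start.
  induction hy using Relation.ReflTransGen.head_induction_on with
  | refl =>
    refine ⟨1, one_mem _, D.translate v y, fun i => ?_, rfl⟩
    rw [D.simpleRoot_translate hl]
    exact_mod_cast hd i
  | head h _ ih =>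
    obtain ⟨i, _, rfl⟩ := h
    obtain ⟨w, hw, z, hz, e⟩ := ih
    refine ⟨D.simpleReflection i * w, mul_mem (D.simpleReflection_mem i) hw, z, hz, ?_⟩
    rw [LinearEquiv.mul_apply, ← e, D.simpleReflection_translate hl,
      reflect_reflect D.isKacMoodyMatrix]

include haff in
/-- The imaginary root: a positive combination of simple roots, invariant under the Weyl
group. -/
theorem exists_imaginary_root : ∃ u : ι → ℝ, (∀ i, 0 < u i) ∧
    (∀ i, ∑ j, u j * D.simpleRoot j (D.simpleCoroot i) = 0) ∧
    ∀ w ∈ D.weylGroup, ∀ v, ∑ j, u j * D.simpleRoot j (w v) = ∑ j, u j * D.simpleRoot j v := by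
  obtain ⟨u, hpos, hu⟩ := haff.exists_pos
  have h0 : ∀ i, ∑ j, u j * D.simpleRoot j (D.simpleCoroot i) = 0 := fun i => by
    have h := congrFun hu i
    simp only [Matrix.mulVec, dotProduct, Matrix.map_apply, Pi.zero_apply] at h
    simpa only [simpleRoot_simpleCoroot_eq, mul_comm] using h
  refine ⟨u, hpos, h0, fun w hw v => ?_⟩
  refine D.weylGroup_stable
    (S := {y | ∑ j, u j * D.simpleRoot j y = ∑ j, u j * D.simpleRoot j v}) ?_ hw rfl
  intro i y hy
  simp only [Set.mem_ofPred_eq] at hy ⊢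
  have e : ∀ j, u j * D.simpleRoot j (D.simpleReflection i y) = u j * D.simpleRoot j y -
      D.simpleRoot i y * (u j * D.simpleRoot j (D.simpleCoroot i)) := fun j => by
    rw [simpleReflection_apply, map_sub, map_smul, smul_eq_mul]
    ring
  simp only [e, Finset.sum_sub_distrib, ← Finset.mul_sum, h0, mul_zero, sub_zero, hy]

include haff in
/-- The heights of the real coroots `w(α_i^∨)` are not bounded above. -/
theorem exists_height_coroot_gt {h : D.Apartment →ₗ[ℝ] ℝ} {N : ℝ} (hN : 0 < N)
    (hc : ∀ i, h (D.simpleCoroot i) = N) (hint : ∀ v ∈ D.cochar, ∃ n : ℤ, h v = n)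
    (i : ι) (M : ℝ) : ∃ w ∈ D.weylGroup, M < h (w (D.simpleCoroot i)) := by
  by_contra! hM
  obtain ⟨u, hpos, h0, hinv⟩ := D.exists_imaginary_root haff
  -- Heights on `Y` are integers, so a bounded orbit has a highest coroot `γ`. Maximality makes `γ`
  -- dominant; since the imaginary root vanishes on it, all simple roots do. Then `γ` is fixed by
  -- $W_0$ and equals $\alpha_i^\vee$, against $\alpha_i(\alpha_i^\vee)=2$.
  obtain ⟨n, ⟨w, hw, hn⟩, hmax⟩ := Int.exists_greatest_of_bdd
    (P := fun n : ℤ => ∃ w ∈ D.weylGroup, h (w (D.simpleCoroot i)) = n)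
    ⟨⌊M⌋, fun z ⟨w, hw, hz⟩ => Int.le_floor.2 (hz ▸ hM w hw)⟩
    (by
      obtain ⟨n, hn⟩ := hint _ (D.simpleCoroot_mem_cochar i)
      exact ⟨n, 1, one_mem _, hn⟩)
  set γ := w (D.simpleCoroot i) with hγ
  have hdom : ∀ j, 0 ≤ D.simpleRoot j γ := fun j => by
    have hw' := mul_mem (D.simpleReflection_mem j) hw
    obtain ⟨m, hm⟩ := hint _ (D.weylGroup_mem_cochar hw' (D.simpleCoroot_mem_cochar i))
    have hle : (m : ℝ) ≤ n := by exact_mod_cast hmax m ⟨_, hw', hm⟩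
    rw [LinearEquiv.mul_apply, ← hγ, simpleReflection_apply, map_sub, map_smul, hc, hn,
      smul_eq_mul] at hm
    exact nonneg_of_mul_nonneg_left (by linarith) hN
  have hsum : ∑ j, u j * D.simpleRoot j γ = 0 := by rw [hγ, hinv w hw, h0]
  have hz : ∀ j, D.simpleRoot j γ = 0 := fun j => by
    have := (Finset.sum_eq_zero_iff_of_nonneg
      fun j _ => mul_nonneg (hpos j).le (hdom j)).1 hsum j (Finset.mem_univ j)
    simpa [(hpos j).ne'] using this
  have hfix : w⁻¹ γ = γ := by
    refine D.weylGroup_stable (S := {γ}) ?_ (inv_mem hw) rfl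
    rintro j _ rfl
    rw [simpleReflection_apply, hz, zero_smul, sub_zero]
    rfl
  have hγ' : w⁻¹ γ = D.simpleCoroot i := by
    rw [hγ, ← LinearEquiv.mul_apply, inv_mul_cancel]
    rfl
  have h2 := D.simpleRoot_simpleCoroot i
  rw [← hγ', hfix, hz] at h2
  norm_num at h2

include hind haff in
-- A finite orbit would have a point of least height, where every simple root is nonpositive; its
-- level would be nonpositive, but the level is invariant and positive at `v`.
theorem infinite_orbit {v : D.Apartment} (hc : v ∈ D.chamber) :
    (D.weylOrbit {v}).Infinite := by
  intro hfin
  obtain ⟨h, N, hN, hcor, -⟩ := D.exists_height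
  obtain ⟨u, hpos, -, hinv⟩ := D.exists_imaginary_root haff
  obtain ⟨_, ⟨w, hw, y, rfl, rfl⟩, hmin⟩ := Set.exists_min_image _ h hfin
    ⟨v, 1, one_mem _, v, rfl, rfl⟩
  have hanti : ∀ j, D.simpleRoot j (w y) ≤ 0 := fun j => by
    have := hmin _ ⟨_, mul_mem (D.simpleReflection_mem j) hw, y, rfl, rfl⟩
    rw [LinearEquiv.mul_apply, simpleReflection_apply, map_sub, map_smul, hcor, smul_eq_mul] at this
    exact nonpos_of_mul_nonpos_left (by linarith) hN
  have h1 : ∑ j, u j * D.simpleRoot j (w y) ≤ 0 :=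
    Finset.sum_nonpos fun j _ => mul_nonpos_of_nonneg_of_nonpos (hpos j).le (hanti j)
  obtain ⟨i⟩ := hind.1
  have h2 : 0 < ∑ j, u j * D.simpleRoot j y :=
    Finset.sum_pos (fun j _ => mul_pos (hpos j) (hc j)) ⟨i, Finset.mem_univ i⟩
  rw [hinv w hw] at h1
  linarith

include hind haff in
theorem weylAlmostFinite_orbit {v : D.Apartment} (hv : v ∈ D.cochar) (hc : v ∈ D.chamber) :
    D.WeylAlmostFinite (D.weylOrbit {v}) := by
  refine ⟨{v}, Set.finite_singleton v, Set.singleton_subset_iff.2 hv, ?_⟩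
  rintro _ ⟨w, hw, _, ⟨w', hw', y, rfl, rfl⟩, rfl⟩
  refine ⟨y, rfl, _, sub_mem_corootCone hind haff hv hc (mul_mem hw hw'), ?_⟩
  rw [LinearEquiv.mul_apply]
  abel

omit [Fintype ι] in
theorem orbit_subset_cocharPlus {v : D.Apartment} (hv : v ∈ D.cochar) (hc : v ∈ D.chamber) :
    D.weylOrbit {v} ⊆ D.cocharPlus := by
  rintro _ ⟨w, hw, y, rfl, rfl⟩
  exact ⟨D.weylGroup_mem_cochar hw hv, w, hw, y, fun i => (hc i).le, rfl⟩

include hind haff in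
-- Since $uwv\le v$, the single point $v+u\alpha_i^\vee$ bounds $u\cdot E$. This bound depends on
-- $u$, which is why nothing uniform over $W_0$ follows.
theorem uAlmostFinite_orbit_add {v : D.Apartment} (hv : v ∈ D.cochar) (hc : v ∈ D.chamber)
    (i : ι) (u : D.weylGroup) :
    D.UAlmostFinite u {x | ∃ w ∈ D.weylGroup, x = w v + D.simpleCoroot i} := by
  classical
  constructor
  · rintro _ ⟨w, hw, rfl⟩
    refine ⟨D.cochar.add_mem (D.weylGroup_mem_cochar hw hv) (D.simpleCoroot_mem_cochar i), ?_⟩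
    obtain ⟨x, hx⟩ := D.exists_translate_of_mem_weylGroup hv hw
    have e : w v + D.simpleCoroot i = D.translate v (x + Pi.single i 1) := by
      rw [translate_add, ← hx, translate_single, one_smul]
    rw [e]
    exact translate_mem_titsCone hind haff hv hc _
  · refine ⟨{v + u.1 (D.simpleCoroot i)}, Set.finite_singleton _, Set.singleton_subset_iff.2
      (D.cochar.add_mem hv (D.weylGroup_mem_cochar u.2 (D.simpleCoroot_mem_cochar i))), ?_⟩
    rintro _ ⟨_, ⟨w, hw, rfl⟩, rfl⟩
    refine ⟨_, rfl, _, sub_mem_corootCone hind haff hv hc (mul_mem u.2 hw), ?_⟩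
    simp only [map_add, LinearEquiv.mul_apply]
    abel

include haff in
theorem not_weylAlmostFinite_orbit_add (v : D.Apartment) (i : ι) :
    ¬ D.WeylAlmostFinite {x | ∃ w ∈ D.weylGroup, x = w v + D.simpleCoroot i} := by
  rintro ⟨J, hJ, -, hsub⟩
  obtain ⟨h, N, hN, hcor, hint⟩ := D.exists_height
  obtain ⟨M, hM⟩ := (hJ.image h).bddAbove
  have hcone : ∀ κ ∈ D.corootCone, 0 ≤ h κ := fun κ hκ => by
    induction hκ using AddSubmonoid.closure_induction with
    | mem x hx =>
      obtain ⟨j, rfl⟩ := hx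
      exact (hcor j).symm ▸ hN.le
    | zero => simp
    | add x y _ _ hx hy => rw [map_add]; exact add_nonneg hx hy
  obtain ⟨w, hw, hlt⟩ := exists_height_coroot_gt haff hN hcor hint i (M - h v)
  -- This point is the image under `w` of $w^{-1}v+\alpha_i^\vee\in E$; by the choice of `w` its
  -- height exceeds the maximum `M` over `J`.
  obtain ⟨ν, hν, κ, hκ, e⟩ := hsub (v + w (D.simpleCoroot i))
    ⟨w, hw, w⁻¹ v + D.simpleCoroot i, ⟨w⁻¹, inv_mem hw, rfl⟩, by
      rw [map_add, ← LinearEquiv.mul_apply, mul_inv_cancel]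
      rfl⟩
  have h1 := hM ⟨ν, hν, rfl⟩
  have h2 := congrArg h e
  rw [map_add, map_sub] at h2
  linarith [hcone κ hκ]

/-! ### Series separating the two completions. -/

variable (R : Type*) [CommRing R] [Nontrivial R]

include hind haff in
-- The witness is $\sum_\mu T_{w_\mu}Z^\mu$ over the orbit of a regular dominant `v`, with one
-- chosen $w_\mu$ such that $w_\mu v=\mu$. If only finitely many $w$ occurred, their values at `v`
-- would exhaust the infinite orbit.
theorem not_hatH_le_tildeH : ¬ D.hatH R ≤ D.tildeH R := by
  classical
  obtain ⟨v, hv, hc⟩ := D.exists_mem_cochar_chamber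
  have hex : ∀ l ∈ D.weylOrbit {v}, ∃ w : D.weylGroup, l = w.1 v := by
    rintro _ ⟨w, hw, y, rfl, rfl⟩
    exact ⟨⟨w, hw⟩, rfl⟩
  choose f hf using hex
  let a : D.Series R := fun w l => if h : l.1 ∈ D.weylOrbit {v} then
    if f l.1 h = w then 1 else 0 else 0
  have ha : ∀ w l, a w l ≠ 0 → ∃ h : l.1 ∈ D.weylOrbit {v}, f l.1 h = w := by
    intro w l h
    simp only [a] at h
    split_ifs at h with h1 h2
    · exact ⟨h1, h2⟩
    · exact (h rfl).elim
    · exact (h rfl).elim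
  have hmem : a ∈ D.hatH R := by
    refine ⟨fun l => Set.Subsingleton.finite ?_,
      (weylAlmostFinite_orbit hind haff hv hc).mono ?_⟩
    · intro w hw w' hw'
      obtain ⟨_, rfl⟩ := ha w l hw
      obtain ⟨_, rfl⟩ := ha w' l hw'
      rfl
    · rintro _ ⟨l, ⟨w, hw⟩, rfl⟩
      exact (ha w l hw).1
  intro hle
  have hfin := (hle hmem).1
  refine infinite_orbit hind haff hc ((hfin.image fun w => w.1 v).subset fun l hl => ?_)
  refine ⟨f l hl, fun h0 => ?_, (hf l hl).symm⟩
  have h1 : a (f l hl) ⟨l, orbit_subset_cocharPlus hv hc hl⟩ = 1 := by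
    simp [a, hl]
  rw [h0] at h1
  exact zero_ne_one h1

include hind haff in
-- The witness is $T_1\sum_{\mu\in E}Z^\mu$: only $w=1$ occurs, and the support `E` is $W_0$-almost
-- finite without being Weyl almost finite.
theorem not_tildeH_le_hatH : ¬ D.tildeH R ≤ D.hatH R := by
  classical
  obtain ⟨v, hv, hc⟩ := D.exists_mem_cochar_chamber
  obtain ⟨i⟩ := hind.1
  set E : Set D.Apartment := {x | ∃ w ∈ D.weylGroup, x = w v + D.simpleCoroot i} with hE
  have hEu : D.W0AlmostFinite E := uAlmostFinite_orbit_add hind haff hv hc i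
  let a : D.Series R := fun w l => if w = 1 ∧ l.1 ∈ E then 1 else 0
  have ha : ∀ w l, a w l ≠ 0 → w = 1 ∧ l.1 ∈ E := fun w l h => by
    by_contra hn
    exact h (if_neg hn)
  have hmem : a ∈ D.tildeH R := by
    refine ⟨(Set.finite_singleton 1).subset fun w hw => ?_, fun w => hEu.mono ?_⟩
    · obtain ⟨l, hl⟩ := Function.ne_iff.1 hw
      exact (ha w l hl).1
    · rintro _ ⟨l, hl, rfl⟩
      exact (ha w l hl).2
  intro hle
  refine not_weylAlmostFinite_orbit_add haff v i ((hle hmem).2.mono fun l hl => ?_)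
  have hl' : l ∈ E := hl
  exact ⟨⟨l, (hEu 1).1 hl'⟩, ⟨1, by simp [a, hl']⟩, rfl⟩

end RootDatum

end KacMoody

/-- For an indecomposable affine Kac-Moody matrix, the set `{w(λ) + α_i^∨ | w ∈ W_0}`, with
`λ ∈ Y ∩ C^v_f`, is `u`-almost finite for all `u ∈ W_0` but not Weyl almost finite, and neither of
the completions `Ĥ` and `H̃` contains the other. -/
theorem mainTheorem8 {ι X Y : Type*} [Fintype ι]
    [AddCommGroup X] [Module.Free ℤ X] [Module.Finite ℤ X]
    [AddCommGroup Y] [Module.Free ℤ Y] [Module.Finite ℤ Y]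
    (D : KacMoody.RootDatum ι X Y)
    (hind : KacMoody.IsIndecomposable D.A) (haff : KacMoody.IsAffine D.A) :
    (∀ l ∈ (D.cochar : Set D.Apartment) ∩ D.chamber, ∀ i : ι,
      (∀ u : D.weylGroup,
        D.UAlmostFinite u {x | ∃ w ∈ D.weylGroup, x = w l + D.simpleCoroot i}) ∧
      ¬ D.WeylAlmostFinite {x | ∃ w ∈ D.weylGroup, x = w l + D.simpleCoroot i}) ∧
    (∀ (R : Type*) [CommRing R] [Nontrivial R],
      ¬ D.hatH R ≤ D.tildeH R ∧ ¬ D.tildeH R ≤ D.hatH R) := by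
  exact ⟨fun l hl i => ⟨KacMoody.RootDatum.uAlmostFinite_orbit_add hind haff hl.1 hl.2 i,
    KacMoody.RootDatum.not_weylAlmostFinite_orbit_add haff l i⟩,
    fun R _ _ => ⟨KacMoody.RootDatum.not_hatH_le_tildeH hind haff R,
      KacMoody.RootDatum.not_tildeH_le_hatH hind haff R⟩⟩
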